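/- Let $\mathbb C\langle\langle x_1,\dots,x_n\rangle\rangle$ denote the algebra of formal power series over $\mathbb C$ in free noncommuting variables; limits and derivatives of functions with values in it are taken coefficientwise, and $t^x:=\exp(x\log t)$ for real $t>0$ and a series $x$ without constant term. Let $A,B$ be free noncommuting variables. The KZ associator is $\Phi(A,B)=G_1^{-1}G_0\in\mathbb C\langle\langle A,B\rangle\rangle$, where $G_0,G_1$ are the invertible solutions on $]0,1[$ of $$(dG)G^{-1}=\Bigl(\frac{A}{u}+\frac{B}{u-1}\Bigr)du$$ such that $G_0(u)\simeq u^A$ as $u\to0^+$ and $G_1(u)\simeq(1-u)^B$ as $u\to1^-$; here $G_0(u)\simeq u^A$ means that $G_0(u)u^{-A}\to1$, and $G_1(u)\simeq(1-u)^B$ means that $G_1(u)(1-u)^{-B}\to 1$. Let $A,b_0,b_1$ be free noncommuting variables. Similarly $\Psi_2(A|b_0,b_1)=H_1^{-1}H_0\in\mathbb C\langle\langle A,b_0,b_1\rangle\rangle$, where $H_0,H_1$ are the invertible solutions on $]0,1[$ of $$(dH)H^{-1}=\Bigl(\frac{A}{z}+\frac{b_0}{z-1}+\frac{b_1}{z+1}\Bigr)dz$$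 such that $H_0(z)\simeq z^A$ as $z\to0^+$ and $H_1(z)\simeq(1-z)^{b_0}$ as $z\to1^-$. Then $\Phi(A,B)$ and $\Psi_2(A|b_0,b_1)$ exist and are uniquely determined by these conditions, and $$\Phi(A,B)=2^B\,\Psi_2(A|B,-A-B)\,2^A ,$$ where $\Psi_2(A|B,-A-B)\in\mathbb C\langle\langle A,B\rangle\rangle$ is obtained from $\Psi_2(A|b_0,b_1)$ by the substitution $b_0\mapsto B$, $b_1\mapsto-A-B$. -/

import Mathlib

/-- Formal power series with complex coefficients in noncommuting free variables indexed by `X`: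
the degree completion of the free associative algebra. A series is the family of its coefficients,
indexed by the words in the variables. -/
def NCSeries (X : Type) : Type := List X → ℂ

namespace NCSeries

/-- The coefficient of the word `w`. -/
def coeff {X : Type} (w : List X) (f : NCSeries X) : ℂ := f w

@[ext] theorem ext {X : Type} {f g : NCSeries X} (h : ∀ w, coeff w f = coeff w g) : f = g :=
  funext h

noncomputable instance instAddCommGroup (X : Type) : AddCommGroup (NCSeries X) :=
  inferInstanceAs (AddCommGroup (List X → ℂ))

noncomputable instance instModule (X : Type) : Module ℂ (NCSeries X) :=
  inferInstanceAs (Module ℂ (List X → ℂ))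

/-- The series `1`, whose only nonzero coefficient is that of the empty word. -/
noncomputable instance instOne (X : Type) : One (NCSeries X) :=
  ⟨fun w => if w.length = 0 then 1 else 0⟩

/-- The Cauchy product: the sum over all the ways to cut the word into two pieces. -/
noncomputable instance instMul (X : Type) : Mul (NCSeries X) :=
  ⟨fun f g w => ∑ p ∈ Finset.HasAntidiagonal.antidiagonal w.length, f (w.take p.1) * g (w.drop p.1)⟩

theorem coeff_zero {X : Type} (w : List X) : coeff w (0 : NCSeries X) = 0 := rfl

theorem coeff_add {X : Type} (w : List X) (f g : NCSeries X) :
    coeff w (f + g) = coeff w f + coeff w g := rfl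

theorem coeff_neg {X : Type} (w : List X) (f : NCSeries X) : coeff w (-f) = -coeff w f := rfl

theorem coeff_smul {X : Type} (w : List X) (c : ℂ) (f : NCSeries X) :
    coeff w (c • f) = c * coeff w f := rfl

theorem coeff_one {X : Type} (w : List X) :
    coeff w (1 : NCSeries X) = if w.length = 0 then 1 else 0 := rfl

theorem coeff_mul {X : Type} (w : List X) (f g : NCSeries X) :
    coeff w (f * g) =
      ∑ p ∈ Finset.HasAntidiagonal.antidiagonal w.length, coeff (w.take p.1) f * coeff (w.drop p.1) g := rfl

protected theorem mul_assoc {X : Type} (f g h : NCSeries X) : f * g * h = f * (g * h) := by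
  ext w
  simp only [coeff_mul, Finset.sum_mul, Finset.mul_sum]
  have h1 : ∀ p ∈ Finset.HasAntidiagonal.antidiagonal w.length,
      (∑ q ∈ Finset.HasAntidiagonal.antidiagonal (w.take p.1).length,
        coeff ((w.take p.1).take q.1) f * coeff ((w.take p.1).drop q.1) g * coeff (w.drop p.1) h)
      = ∑ q ∈ Finset.HasAntidiagonal.antidiagonal p.1, coeff (w.take q.1) f *
        (coeff ((w.drop q.1).take q.2) g * coeff (w.drop (q.1 + q.2)) h) := by
    intro p hp
    have hp' := Finset.HasAntidiagonal.mem_antidiagonal.1 hp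
    rw [List.length_take, min_eq_left (by omega)]
    refine Finset.sum_congr rfl fun q hq => ?_
    have hq' := Finset.HasAntidiagonal.mem_antidiagonal.1 hq
    rw [List.take_take, min_eq_left (by omega), List.drop_take, hq', mul_assoc,
      show p.1 - q.1 = q.2 by omega]
  have h2 : ∀ p ∈ Finset.HasAntidiagonal.antidiagonal w.length,
      (∑ q ∈ Finset.HasAntidiagonal.antidiagonal (w.drop p.1).length,
        coeff (w.take p.1) f *
          (coeff ((w.drop p.1).take q.1) g * coeff ((w.drop p.1).drop q.1) h))
      = ∑ q ∈ Finset.HasAntidiagonal.antidiagonal p.2, coeff (w.take p.1) f *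
        (coeff ((w.drop p.1).take q.1) g * coeff (w.drop (p.1 + q.1)) h) := by
    intro p hp
    have hp' := Finset.HasAntidiagonal.mem_antidiagonal.1 hp
    rw [List.length_drop, show w.length - p.1 = p.2 by omega]
    refine Finset.sum_congr rfl fun q _ => ?_
    rw [List.drop_drop]
  rw [Finset.sum_congr rfl h1, Finset.sum_congr rfl h2]
  rw [Finset.sum_sigma', Finset.sum_sigma']
  refine Finset.sum_bij' (fun x _ => ⟨(x.2.1, x.2.2 + x.1.2), (x.2.2, x.1.2)⟩)
    (fun x _ => ⟨(x.1.1 + x.2.1, x.2.2), (x.1.1, x.2.1)⟩) ?_ ?_ ?_ ?_ ?_ <;>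
    rintro ⟨⟨a, b⟩, ⟨c, d⟩⟩ hx <;>
    simp only [Finset.mem_sigma, Finset.HasAntidiagonal.mem_antidiagonal] at hx ⊢ <;>
    obtain ⟨hx1, hx2⟩ := hx <;> subst hx2 <;> (try simp) <;> omega

noncomputable instance instRing (X : Type) : Ring (NCSeries X) :=
  { instAddCommGroup X, instMul X, instOne X with
    mul_assoc := NCSeries.mul_assoc
    left_distrib := by
      intro f g h
      ext w
      simp only [coeff_add, coeff_mul, mul_add, Finset.sum_add_distrib]
    right_distrib := by
      intro f g h
      ext w
      simp only [coeff_add, coeff_mul, add_mul, Finset.sum_add_distrib]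
    zero_mul := by
      intro f
      ext w
      simp only [coeff_zero, coeff_mul, zero_mul, Finset.sum_const_zero]
    mul_zero := by
      intro f
      ext w
      simp only [coeff_zero, coeff_mul, mul_zero, Finset.sum_const_zero]
    one_mul := by
      intro f
      ext w
      rw [coeff_mul, Finset.sum_eq_single (0, w.length)]
      · simp [coeff_one]
      · rintro ⟨a, b⟩ hp hne
        have hp' := Finset.HasAntidiagonal.mem_antidiagonal.1 hp
        simp only at hp'
        have ha : ¬ (w.take a).length = 0 := by
          intro h0
          rw [List.length_take] at h0
          apply hne
          have : a = 0 := by omega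
          subst this
          simp at hp'
          simp [hp']
        simp only [coeff_one, ha, if_false, zero_mul]
      · simp
    mul_one := by
      intro f
      ext w
      rw [coeff_mul, Finset.sum_eq_single (w.length, 0)]
      · simp [coeff_one]
      · rintro ⟨a, b⟩ hp hne
        have hp' := Finset.HasAntidiagonal.mem_antidiagonal.1 hp
        simp only at hp'
        have ha : ¬ (w.drop a).length = 0 := by
          intro h0
          rw [List.length_drop] at h0
          apply hne
          have : b = 0 := by omega
          subst this
          simp at hp'
          simp [hp']
        simp only [coeff_one, ha, if_false, mul_zero]
      · simp
    zsmul := (instAddCommGroup X).zsmul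
    zsmul_zero' := (instAddCommGroup X).zsmul_zero'
    zsmul_succ' := (instAddCommGroup X).zsmul_succ'
    zsmul_neg' := (instAddCommGroup X).zsmul_neg' }

/-- The free variable indexed by `x`. -/
noncomputable def var {X : Type} [DecidableEq X] (x : X) : NCSeries X :=
  fun w => if w = [x] then 1 else 0

/-- The exponential `∑ xᵏ / k!` of a series `x` without constant term. The coefficient of `w` is a
finite sum, since `xᵏ` has no term of degree less than `k`. -/
noncomputable def exp {X : Type} (x : NCSeries X) : NCSeries X :=
  fun w => ∑ k ∈ Finset.range (w.length + 1), ((k.factorial : ℂ))⁻¹ * coeff w (x ^ k)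

/-- `t ^ x = exp (x log t)` for a real number `t > 0` and a series `x` without constant term. -/
noncomputable def rpow {X : Type} (t : ℝ) (x : NCSeries X) : NCSeries X :=
  exp ((Real.log t : ℂ) • x)

/-- Substitution in `f` of a series `s x` without constant term for each variable `x`, that is the
image of `f` under the continuous algebra morphism given by `x ↦ s x`. It is the sum over all words
`v` of the coefficient of `v` in `f` times the product of the `s x` along `v`; for the coefficient
of `w` only the words `v` of length at most the length of `w` contribute. -/
noncomputable def subst {X Y : Type} [Fintype X] (s : X → NCSeries Y) (f : NCSeries X) :
    NCSeries Y :=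
  fun w => ∑ k ∈ Finset.range (w.length + 1), ∑ v : Fin k → X,
    coeff (List.ofFn v) f * coeff w ((List.ofFn v).map s).prod

end NCSeries

/-- `G` is an (invertible) solution on `]0,1[` of `(dG) G⁻¹ = ω(u) du`, that is of
`dG/du = ω(u) G(u)`, the derivative being taken in each coefficient. -/
def IsSolution {X : Type} (ω : ℝ → NCSeries X) (G : ℝ → (NCSeries X)ˣ) : Prop :=
  ∀ u ∈ Set.Ioo (0 : ℝ) 1, ∀ w : List X,
    HasDerivAt (fun t : ℝ => NCSeries.coeff w (G t : NCSeries X))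
      (NCSeries.coeff w (ω u * (G u : NCSeries X))) u

/-- `G(u) ≃ u ^ a` as `u → 0⁺`: in each coefficient, `G(u) u ^ (-a)` tends to `1`. -/
def IsAsympZero {X : Type} (a : NCSeries X) (G : ℝ → (NCSeries X)ˣ) : Prop :=
  ∀ w : List X, Filter.Tendsto
    (fun u : ℝ => NCSeries.coeff w ((G u : NCSeries X) * NCSeries.rpow u (-a)))
    (nhdsWithin 0 (Set.Ioi 0)) (nhds (NCSeries.coeff w 1))

/-- `G(u) ≃ (1 - u) ^ b` as `u → 1⁻`: in each coefficient, `G(u) (1 - u) ^ (-b)` tends to `1`. -/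
def IsAsympOne {X : Type} (b : NCSeries X) (G : ℝ → (NCSeries X)ˣ) : Prop :=
  ∀ w : List X, Filter.Tendsto
    (fun u : ℝ => NCSeries.coeff w ((G u : NCSeries X) * NCSeries.rpow (1 - u) (-b)))
    (nhdsWithin 1 (Set.Iio 1)) (nhds (NCSeries.coeff w 1))

/-- `P` is the renormalized holonomy from `0` to `1` of `(dG) G⁻¹ = ω(u) du`: `P = G₁⁻¹ G₀`, where
`G₀`, `G₁` are the solutions on `]0,1[` with `G₀(u) ≃ u ^ a` as `u → 0⁺` and
`G₁(u) ≃ (1 - u) ^ b` as `u → 1⁻`. -/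
def IsRenormalizedHolonomy {X : Type} (ω : ℝ → NCSeries X) (a b P : NCSeries X) : Prop :=
  ∃ G₀ G₁ : ℝ → (NCSeries X)ˣ,
    IsSolution ω G₀ ∧ IsAsympZero a G₀ ∧
    IsSolution ω G₁ ∧ IsAsympOne b G₁ ∧
    ∀ u ∈ Set.Ioo (0 : ℝ) 1, P = ((G₁ u)⁻¹ : (NCSeries X)ˣ) * (G₀ u : NCSeries X)

/-- `Φ` is the KZ associator `Φ(A, B)` in the free variables `A = var 0`, `B = var 1`: the
renormalized holonomy of `(dG) G⁻¹ = (A / u + B / (u - 1)) du`. -/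
def IsKZAssociator (Φ : NCSeries (Fin 2)) : Prop :=
  IsRenormalizedHolonomy
    (fun u : ℝ => ((u : ℂ)⁻¹) • NCSeries.var (0 : Fin 2)
      + (((u : ℂ) - 1)⁻¹) • NCSeries.var (1 : Fin 2))
    (NCSeries.var 0) (NCSeries.var 1) Φ

/-- `Ψ` is the generalized associator `Ψ₂(A | b₀, b₁)` in the free variables `A = var 0`,
`b₀ = var 1`, `b₁ = var 2`: the renormalized holonomy of
`(dH) H⁻¹ = (A / z + b₀ / (z - 1) + b₁ / (z + 1)) dz`. -/
def IsPsiTwo (Ψ : NCSeries (Fin 3)) : Prop :=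
  IsRenormalizedHolonomy
    (fun z : ℝ => ((z : ℂ)⁻¹) • NCSeries.var (0 : Fin 3)
      + (((z : ℂ) - 1)⁻¹) • NCSeries.var (1 : Fin 3)
      + (((z : ℂ) + 1)⁻¹) • NCSeries.var (2 : Fin 3))
    (NCSeries.var 0) (NCSeries.var 1) Ψ

/-- The KZ associator `Φ(A, B)`. -/
noncomputable def kzAssociator : NCSeries (Fin 2) := Classical.epsilon IsKZAssociator

/-- The generalized associator `Ψ₂(A | b₀, b₁)` in free variables. -/
noncomputable def psiTwo : NCSeries (Fin 3) := Classical.epsilon IsPsiTwo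

/-!
The Möbius map `u = 2 z / (1 + z)` fixes `0` and `1` and pulls the form
`A du / u + B du / (u - 1)` back to `A dz / z + B dz / (z - 1) - (A + B) dz / (z + 1)`
(`moebius_pullback`). As `u ~ 2 z` at `0` and `1 - u ~ (1 - z) / 2` at `1`, a solution `G₀ ≃ u ^ A`
becomes `G₀ 2 ^ (-A) ≃ z ^ A`, and a solution `G₁ ≃ (1 - u) ^ B` becomes
`G₁ 2 ^ B ≃ (1 - z) ^ B`. Hence `2 ^ (-B) Φ 2 ^ (-A)` is a renormalized holonomy of the pulled back
equation (`IsKZAssociator.moebius`). The substitution `b₀ ↦ B`, `b₁ ↦ -A - B` is a continuous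
morphism of algebras (`substHom`), so that it carries the holonomy `Ψ₂` to a renormalized holonomy
of the same equation (`IsRenormalizedHolonomy.subst`). The two agree by uniqueness.

Uniqueness (`IsRenormalizedHolonomy.unique`): two solutions differ by a constant right factor `C`,
since a solution of a linear equation without constant term that vanishes at a point is zero, by
induction on the degree. If both have the same normalization, then `C = 1`, because the term of
lowest degree of `C - 1` is not changed by the invertible factors around it
(`eq_one_of_tendsto`).

Existence (`exists_isSolution_isAsympZero`): near a simple pole at `0` with residue a letter `a`,
the coefficients of the powers of `a` are those of `u ^ a`, and the coefficient of any other word is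
the integral from `0` of what the equation prescribes. By induction on the word these coefficients
are `O(u ^ (1/2))`, so the integrals converge and the difference with `u ^ a` is negligible against
the powers of `log u` in `u ^ (-a)`. The point `1` is reduced to `0` by reflection.
-/

namespace NCSeries

variable {X Y : Type}

/-! ### The algebra of noncommutative series and its degree filtration -/

theorem coeff_sub (w : List X) (f g : NCSeries X) :
    coeff w (f - g) = coeff w f - coeff w g := by
  rw [sub_eq_add_neg, coeff_add, coeff_neg, sub_eq_add_neg]

theorem coeff_sum {ι : Type*} (s : Finset ι) (F : ι → NCSeries X) (w : List X) :
    coeff w (∑ i ∈ s, F i) = ∑ i ∈ s, coeff w (F i) := by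
  classical
  induction s using Finset.induction_on with
  | empty => simp [coeff_zero]
  | insert i s hi ih => rw [Finset.sum_insert hi, Finset.sum_insert hi, coeff_add, ih]

noncomputable instance instAlgebra (X : Type) : Algebra ℂ (NCSeries X) :=
  Algebra.ofModule
    (fun c f g => by
      ext w
      simp only [coeff_smul, coeff_mul, Finset.mul_sum, mul_assoc])
    (fun c f g => by
      ext w
      simp only [coeff_smul, coeff_mul, Finset.mul_sum]
      exact Finset.sum_congr rfl fun p _ => by ring)

theorem coeff_nil_mul (f g : NCSeries X) : coeff [] (f * g) = coeff [] f * coeff [] g := by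
  simp [coeff_mul]

theorem coeff_nil_one : coeff [] (1 : NCSeries X) = 1 := by simp [coeff_one]

/-- The ideal of the series whose terms all have degree at least `n`. -/
def degGE (X : Type) (n : ℕ) : Submodule ℂ (NCSeries X) where
  carrier := {f | ∀ w : List X, w.length < n → coeff w f = 0}
  add_mem' hf hg w hw := by rw [coeff_add, hf w hw, hg w hw, add_zero]
  zero_mem' w _ := coeff_zero w
  smul_mem' c f hf w hw := by rw [coeff_smul, hf w hw, mul_zero]

theorem mem_degGE_one {f : NCSeries X} : f ∈ degGE X 1 ↔ coeff [] f = 0 := by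
  constructor
  · intro h
    exact h [] (by simp)
  · intro h w hw
    obtain rfl : w = [] := List.length_eq_zero_iff.1 (by omega)
    exact h

theorem degGE_mono {m n : ℕ} (h : m ≤ n) : degGE X n ≤ degGE X m :=
  fun _ hf w hw => hf w (hw.trans_le h)

theorem mul_mem_degGE {m n : ℕ} {f g : NCSeries X} (hf : f ∈ degGE X m) (hg : g ∈ degGE X n) :
    f * g ∈ degGE X (m + n) := by
  intro w hw
  rw [coeff_mul]
  refine Finset.sum_eq_zero fun p hp => ?_
  have hp' := Finset.HasAntidiagonal.mem_antidiagonal.1 hp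
  by_cases h : p.1 < m
  · rw [hf _ (by rw [List.length_take]; omega), zero_mul]
  · rw [hg _ (by rw [List.length_drop]; omega), mul_zero]

theorem mem_degGE_zero (f : NCSeries X) : f ∈ degGE X 0 := fun _ hw => absurd hw (by omega)

theorem pow_mem_degGE {f : NCSeries X} (hf : f ∈ degGE X 1) (n : ℕ) : f ^ n ∈ degGE X n := by
  induction n with
  | zero => exact mem_degGE_zero _
  | succ n ih => rw [pow_succ]; exact mul_mem_degGE ih hf

theorem mul_sub_mul_mem_degGE {n : ℕ} {f f' g g' : NCSeries X} (hf : f - f' ∈ degGE X n)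
    (hg : g - g' ∈ degGE X n) : f * g - f' * g' ∈ degGE X n := by
  have h : f * g - f' * g' = (f - f') * g + f' * (g - g') := by noncomm_ring
  rw [h]
  refine add_mem ?_ ?_
  · simpa using mul_mem_degGE hf (mem_degGE_zero g)
  · simpa using mul_mem_degGE (mem_degGE_zero f') hg

theorem coeff_eq_of_sub_mem {n : ℕ} {f g : NCSeries X} (h : f - g ∈ degGE X n) {w : List X}
    (hw : w.length < n) : coeff w f = coeff w g := by
  have := h w hw
  rwa [coeff_sub, sub_eq_zero] at this

/-- Multiplication of a series without terms of degree less than `k` by other series acts on its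
terms of degree `k` through the constant terms of the factors. -/
theorem coeff_mul_mul_of_length_eq {k : ℕ} {f g h : NCSeries X} (hg : g ∈ degGE X k) {w : List X}
    (hw : w.length = k) : coeff w (f * g * h) = coeff [] f * coeff w g * coeff [] h := by
  set f' := f - coeff [] f • 1
  set h' := h - coeff [] h • 1
  have hf' : f' ∈ degGE X 1 := by
    rw [mem_degGE_one, coeff_sub, coeff_smul, coeff_nil_one, mul_one, sub_self]
  have hh' : h' ∈ degGE X 1 := by
    rw [mem_degGE_one, coeff_sub, coeff_smul, coeff_nil_one, mul_one, sub_self]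
  have e : f * g * h = (coeff [] f * coeff [] h) • g + (f' * g * h + (coeff [] f) • (g * h')) := by
    simp only [f', h', sub_mul, mul_sub, smul_mul_assoc, mul_smul_comm, one_mul, mul_one, smul_sub,
      mul_smul]
    abel
  have h1 : f' * g * h ∈ degGE X (k + 1) := by
    have := mul_mem_degGE (mul_mem_degGE hf' hg) (mem_degGE_zero h)
    rwa [add_zero, add_comm] at this
  have h2 := (degGE X (k + 1)).smul_mem (coeff [] f) (mul_mem_degGE hg hh')
  rw [e, coeff_add, (add_mem h1 h2) w (by omega), coeff_smul]
  ring

/-! ### Evaluation of power series in one variable -/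

/-- The value `∑ pₖ aᵏ` of a power series `p` in one variable at a series `a` without constant
term. -/
noncomputable def evalPS (a : NCSeries X) (p : PowerSeries ℂ) : NCSeries X :=
  fun w => coeff w (Polynomial.aeval a (PowerSeries.trunc (w.length + 1) p))

theorem aeval_mem_degGE {a : NCSeries X} (ha : a ∈ degGE X 1) {n : ℕ} {q : Polynomial ℂ}
    (hq : ∀ i < n, q.coeff i = 0) : Polynomial.aeval a q ∈ degGE X n := by
  rw [Polynomial.aeval_eq_sum_range]
  refine sum_mem fun i _ => ?_
  by_cases h : i < n
  · rw [hq i h, zero_smul]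
    exact zero_mem _
  · exact Submodule.smul_mem _ _ (degGE_mono (not_lt.1 h) (pow_mem_degGE ha i))

theorem evalPS_sub_aeval_mem {a : NCSeries X} (ha : a ∈ degGE X 1) (p : PowerSeries ℂ) (n : ℕ) :
    evalPS a p - Polynomial.aeval a (PowerSeries.trunc n p) ∈ degGE X n := by
  intro w hw
  rw [coeff_sub]
  change coeff w (Polynomial.aeval a (PowerSeries.trunc (w.length + 1) p)) - _ = 0
  rw [← coeff_sub, ← map_sub]
  refine aeval_mem_degGE ha (n := w.length + 1) (fun i hi => ?_) w (by omega)
  rw [Polynomial.coeff_sub, PowerSeries.coeff_trunc, PowerSeries.coeff_trunc, if_pos hi,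
    if_pos (by omega), sub_self]

theorem evalPS_mul {a : NCSeries X} (ha : a ∈ degGE X 1) (p q : PowerSeries ℂ) :
    evalPS a (p * q) = evalPS a p * evalPS a q := by
  ext w
  set n := w.length + 1
  have h1 := mul_sub_mul_mem_degGE (evalPS_sub_aeval_mem ha p n) (evalPS_sub_aeval_mem ha q n)
  rw [coeff_eq_of_sub_mem h1 (by omega), coeff_eq_of_sub_mem (evalPS_sub_aeval_mem ha (p * q) n)
    (by omega), ← map_mul]
  refine coeff_eq_of_sub_mem (n := n) ?_ (by omega)
  rw [← map_sub]
  refine aeval_mem_degGE ha fun i hi => ?_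
  rw [Polynomial.coeff_sub, PowerSeries.coeff_trunc, if_pos hi,
    PowerSeries.coeff_mul_eq_coeff_trunc_mul_trunc p q hi, ← Polynomial.coe_mul,
    Polynomial.coeff_coe, sub_self]

theorem evalPS_one (a : NCSeries X) : evalPS a 1 = 1 := by
  ext w
  change coeff w (Polynomial.aeval a (PowerSeries.trunc (w.length + 1) 1)) = _
  rw [PowerSeries.trunc_one, map_one]

theorem coeff_evalPS (a : NCSeries X) (p : PowerSeries ℂ) (w : List X) :
    coeff w (evalPS a p) =
      ∑ k ∈ Finset.range (w.length + 1), PowerSeries.coeff k p * coeff w (a ^ k) := by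
  change coeff w (Polynomial.aeval a (PowerSeries.trunc (w.length + 1) p)) = _
  rw [Polynomial.aeval_eq_sum_range' (PowerSeries.natDegree_trunc_lt p _), coeff_sum]
  refine Finset.sum_congr rfl fun k hk => ?_
  rw [coeff_smul, PowerSeries.coeff_trunc, if_pos (Finset.mem_range.1 hk)]

/-- A series with constant term `1` is invertible: it is `1 - a` with `a` without constant term,
and its inverse is the geometric series of `a`. -/
theorem isUnit_of_coeff_nil_eq_one {f : NCSeries X} (hf : coeff [] f = 1) : IsUnit f := by
  set a := 1 - f
  have ha : a ∈ degGE X 1 := by rw [mem_degGE_one, coeff_sub, hf, coeff_nil_one, sub_self]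
  have h1 : evalPS a (1 - PowerSeries.X) = f := by
    ext w
    rw [coeff_eq_of_sub_mem (evalPS_sub_aeval_mem ha _ (w.length + 2)) (by omega)]
    have : PowerSeries.trunc (w.length + 2) (1 - PowerSeries.X : PowerSeries ℂ)
        = 1 - Polynomial.X := by
      rw [PowerSeries.trunc_sub, PowerSeries.trunc_one, PowerSeries.trunc_X]
    rw [this, map_sub, map_one, Polynomial.aeval_X, sub_sub_cancel]
  have hu : IsUnit (1 - PowerSeries.X : PowerSeries ℂ) := by
    rw [PowerSeries.isUnit_iff_constantCoeff]
    simp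
  obtain ⟨v, hv⟩ := hu
  rw [← h1, ← hv]
  refine ⟨⟨evalPS a v, evalPS a (v⁻¹ : (PowerSeries ℂ)ˣ), ?_, ?_⟩, rfl⟩
  · rw [← evalPS_mul ha, Units.mul_inv, evalPS_one]
  · rw [← evalPS_mul ha, Units.inv_mul, evalPS_one]

/-! ### Exponentials -/

theorem coeff_exp_smul (c : ℂ) (a : NCSeries X) (w : List X) :
    coeff w (exp (c • a)) = ∑ k ∈ Finset.range (w.length + 1),
      c ^ k * ((k.factorial : ℂ)⁻¹ * coeff w (a ^ k)) := by
  change ∑ k ∈ Finset.range (w.length + 1), _ = _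
  refine Finset.sum_congr rfl fun k _ => ?_
  rw [smul_pow, coeff_smul]
  ring

theorem exp_smul_eq_evalPS (c : ℂ) (a : NCSeries X) :
    exp (c • a) = evalPS a (PowerSeries.rescale c (PowerSeries.exp ℂ)) := by
  ext w
  rw [coeff_exp_smul, coeff_evalPS]
  refine Finset.sum_congr rfl fun k _ => ?_
  simp [PowerSeries.coeff_rescale, PowerSeries.coeff_exp, mul_assoc]

theorem exp_smul_mul_exp_smul {a : NCSeries X} (ha : a ∈ degGE X 1) (c d : ℂ) :
    exp (c • a) * exp (d • a) = exp ((c + d) • a) := by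
  rw [exp_smul_eq_evalPS, exp_smul_eq_evalPS, exp_smul_eq_evalPS, ← evalPS_mul ha,
    PowerSeries.exp_mul_exp_eq_exp_add]

theorem exp_zero : exp (0 : NCSeries X) = 1 := by
  have := exp_smul_eq_evalPS 0 (0 : NCSeries X)
  rw [zero_smul, PowerSeries.rescale_zero] at this
  simpa [evalPS_one] using this

theorem rpow_neg (t : ℝ) (a : NCSeries X) : rpow t (-a) = exp ((-(Real.log t : ℂ)) • a) := by
  rw [rpow, smul_neg, neg_smul]

theorem rpow_mul_rpow_neg {a : NCSeries X} (ha : a ∈ degGE X 1) (t : ℝ) :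
    rpow t a * rpow t (-a) = 1 := by
  rw [rpow_neg, rpow, exp_smul_mul_exp_smul ha, add_neg_cancel, zero_smul, exp_zero]

theorem rpow_neg_mul_rpow {a : NCSeries X} (ha : a ∈ degGE X 1) (t : ℝ) :
    rpow t (-a) * rpow t a = 1 := by
  rw [rpow_neg, rpow, exp_smul_mul_exp_smul ha, neg_add_cancel, zero_smul, exp_zero]

/-- `t ^ a` as an invertible series, with inverse `t ^ (-a)`. -/
noncomputable def rpowUnit {a : NCSeries X} (ha : a ∈ degGE X 1) (t : ℝ) : (NCSeries X)ˣ :=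
  ⟨rpow t a, rpow t (-a), rpow_mul_rpow_neg ha t, rpow_neg_mul_rpow ha t⟩

/-! ### Words in the variables -/

section Var

variable [DecidableEq X]

theorem coeff_var (w : List X) (x : X) : coeff w (var x) = if w = [x] then 1 else 0 := rfl

theorem var_mem_degGE_one (x : X) : var x ∈ degGE X 1 := by
  rw [mem_degGE_one, coeff_var, if_neg (List.cons_ne_nil x []).symm]

theorem coeff_nil_var_mul (x : X) (f : NCSeries X) : coeff [] (var x * f) = 0 := by
  rw [coeff_nil_mul, mem_degGE_one.1 (var_mem_degGE_one x), zero_mul]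

theorem coeff_cons_var_mul (x y : X) (w : List X) (f : NCSeries X) :
    coeff (y :: w) (var x * f) = if y = x then coeff w f else 0 := by
  rw [coeff_mul, Finset.sum_eq_single (1, w.length)]
  · have : coeff ((y :: w).take 1) (var x) = if y = x then 1 else 0 := by
      simp [coeff_var]
    rw [this]
    simp
  · rintro ⟨i, j⟩ hp hne
    have hp' := Finset.HasAntidiagonal.mem_antidiagonal.1 hp
    simp only [List.length_cons] at hp'
    have : coeff ((y :: w).take i) (var x) = 0 := by
      rw [coeff_var]
      refine if_neg fun h => hne ?_
      have := congrArg List.length h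
      simp only [List.length_take, List.length_cons, List.length_nil] at this
      ext <;> simp <;> omega
    rw [this, zero_mul]
  · intro h
    exact absurd (Finset.HasAntidiagonal.mem_antidiagonal.2 (by simp; omega)) h

theorem coeff_prod_map_var (v w : List X) :
    coeff w (v.map var).prod = if w = v then 1 else 0 := by
  induction v generalizing w with
  | nil => simp [coeff_one]
  | cons x v ih =>
    rw [List.map_cons, List.prod_cons]
    cases w with
    | nil => rw [coeff_nil_var_mul]; simp
    | cons y w =>
      rw [coeff_cons_var_mul, ih]
      simp only [List.cons.injEq]
      split_ifs <;> simp_all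

theorem coeff_var_pow (x : X) (k : ℕ) (w : List X) :
    coeff w (var x ^ k) = if w = List.replicate k x then 1 else 0 := by
  rw [← coeff_prod_map_var, List.map_replicate, List.prod_replicate]

end Var

/-! ### Substitution -/

section Subst

theorem list_map_prod_mem_degGE {s : X → NCSeries Y} (hs : ∀ x, s x ∈ degGE Y 1) (v : List X) :
    (v.map s).prod ∈ degGE Y v.length := by
  induction v with
  | nil => exact mem_degGE_zero _
  | cons x v ih =>
    rw [List.map_cons, List.prod_cons, List.length_cons, add_comm]
    exact mul_mem_degGE (hs x) ih

variable [Fintype X]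

theorem coeff_subst (s : X → NCSeries Y) (f : NCSeries X) (w : List Y) :
    coeff w (subst s f) = ∑ k ∈ Finset.range (w.length + 1), ∑ v : Fin k → X,
      coeff (List.ofFn v) f * coeff w ((List.ofFn v).map s).prod := rfl

theorem sum_words_ite_eq [DecidableEq X] (n : ℕ) (v : List X) (c : ℂ) :
    ∑ k ∈ Finset.range n, ∑ v' : Fin k → X, (if List.ofFn v' = v then c else 0) =
      if v.length < n then c else 0 := by
  have h : ∀ k, ∀ v' : Fin k → X, List.ofFn v' = v → k = v.length := by
    rintro k v' rfl
    simp
  have h0 : ∀ k, k ≠ v.length → ∑ v' : Fin k → X, (if List.ofFn v' = v then c else 0) = 0 :=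
    fun k hk => Finset.sum_eq_zero fun v' _ => if_neg fun e => hk (h k v' e)
  split_ifs with hn
  · rw [Finset.sum_eq_single v.length (fun k _ hk => h0 k hk)
      (fun hk => absurd (Finset.mem_range.2 hn) hk), Finset.sum_eq_single v.get]
    · rw [if_pos (List.ofFn_get v)]
    · intro v' _ hne
      refine if_neg fun e => hne ?_
      refine List.ofFn_injective ?_
      rw [e, List.ofFn_get]
    · intro hv
      exact absurd (Finset.mem_univ _) hv
  · refine Finset.sum_eq_zero fun k hk => h0 k ?_
    rintro rfl
    exact hn (Finset.mem_range.1 hk)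

/-- Substitution as a linear map. -/
noncomputable def substLinear (s : X → NCSeries Y) : NCSeries X →ₗ[ℂ] NCSeries Y where
  toFun := subst s
  map_add' f g := by
    ext w
    simp only [coeff_add, coeff_subst, add_mul, Finset.sum_add_distrib]
  map_smul' c f := by
    ext w
    simp only [coeff_smul, coeff_subst, Finset.mul_sum, mul_assoc, RingHom.id_apply]

theorem substLinear_apply (s : X → NCSeries Y) (f : NCSeries X) :
    substLinear s f = subst s f := rfl

theorem subst_mem_degGE (s : X → NCSeries Y) {n : ℕ} {f : NCSeries X} (hf : f ∈ degGE X n) :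
    subst s f ∈ degGE Y n := by
  intro w hw
  rw [coeff_subst]
  refine Finset.sum_eq_zero fun k hk => Finset.sum_eq_zero fun v _ => ?_
  have := Finset.mem_range.1 hk
  rw [hf _ (by rw [List.length_ofFn]; omega), zero_mul]

variable [DecidableEq X]

theorem subst_prod_map_var {s : X → NCSeries Y} (hs : ∀ x, s x ∈ degGE Y 1) (v : List X) :
    subst s (v.map var).prod = (v.map s).prod := by
  ext w
  rw [coeff_subst]
  have h : ∀ k, ∀ v' : Fin k → X, coeff (List.ofFn v') (v.map var).prod *
      coeff w ((List.ofFn v').map s).prod =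
        if List.ofFn v' = v then coeff w (v.map s).prod else 0 := by
    intro k v'
    rw [coeff_prod_map_var]
    split_ifs with e
    · rw [e, one_mul]
    · rw [zero_mul]
  simp only [h]
  rw [sum_words_ite_eq]
  split_ifs with hv
  · rfl
  · exact (list_map_prod_mem_degGE hs v w (by omega)).symm

/-- Up to terms of degree at least `n`, every series is a noncommutative polynomial. -/
theorem exists_mem_span_sub_mem_degGE (f : NCSeries X) (n : ℕ) :
    ∃ g ∈ Submodule.span ℂ (Set.range fun v : List X => (v.map var).prod), f - g ∈ degGE X n := by
  refine ⟨∑ k ∈ Finset.range n, ∑ v : Fin k → X,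
    coeff (List.ofFn v) f • ((List.ofFn v).map var).prod, ?_, ?_⟩
  · exact sum_mem fun k _ => sum_mem fun v _ =>
      Submodule.smul_mem _ _ (Submodule.subset_span ⟨_, rfl⟩)
  · intro w hw
    have h : ∀ k, ∀ v : Fin k → X, coeff (List.ofFn v) f *
        coeff w ((List.ofFn v).map var).prod = if List.ofFn v = w then coeff w f else 0 := by
      intro k v
      rw [coeff_prod_map_var]
      by_cases e : List.ofFn v = w
      · rw [if_pos e.symm, if_pos e, mul_one, e]
      · rw [if_neg (Ne.symm e), if_neg e, mul_zero]
    simp only [coeff_sub, coeff_sum, coeff_smul, h]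
    rw [sum_words_ite_eq, if_pos hw, sub_self]

/-- Multiplicativity holds for monomials, hence for polynomials, and both sides only depend on the
factors modulo terms of high degree. -/
theorem subst_mul {s : X → NCSeries Y} (hs : ∀ x, s x ∈ degGE Y 1) (f g : NCSeries X) :
    subst s (f * g) = subst s f * subst s g := by
  have hpoly : ∀ f ∈ Submodule.span ℂ (Set.range fun v : List X => (v.map var).prod),
      ∀ g ∈ Submodule.span ℂ (Set.range fun v : List X => (v.map var).prod),
      substLinear s (f * g) = substLinear s f * substLinear s g := by
    intro f hf g hg
    induction hf using Submodule.span_induction with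
    | mem f hf =>
      obtain ⟨v, rfl⟩ := hf
      induction hg using Submodule.span_induction with
      | mem g hg =>
        obtain ⟨v', rfl⟩ := hg
        simp only [substLinear_apply]
        rw [subst_prod_map_var hs, subst_prod_map_var hs, ← List.prod_append, ← List.map_append,
          subst_prod_map_var hs, List.map_append, List.prod_append]
      | zero => simp
      | add g g' _ _ h h' => rw [mul_add, map_add, map_add, mul_add, h, h']
      | smul c g _ h => rw [mul_smul_comm, map_smul, map_smul, mul_smul_comm, h]
    | zero => simp
    | add f f' _ _ h h' => rw [add_mul, map_add, map_add, add_mul, h, h']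
    | smul c f _ h => rw [smul_mul_assoc, map_smul, map_smul, smul_mul_assoc, h]
  ext w
  obtain ⟨f', hf', hf⟩ := exists_mem_span_sub_mem_degGE f (w.length + 1)
  obtain ⟨g', hg', hg⟩ := exists_mem_span_sub_mem_degGE g (w.length + 1)
  have key : ∀ {a b : NCSeries X}, a - b ∈ degGE X (w.length + 1) →
      subst s a - subst s b ∈ degGE Y (w.length + 1) := by
    intro a b h
    have := subst_mem_degGE s h
    rwa [← substLinear_apply, map_sub] at this
  rw [coeff_eq_of_sub_mem (key (mul_sub_mul_mem_degGE hf hg)) (by omega),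
    coeff_eq_of_sub_mem (mul_sub_mul_mem_degGE (key hf) (key hg)) (by omega)]
  exact congrArg (coeff w) (hpoly f' hf' g' hg')

theorem subst_one {s : X → NCSeries Y} (hs : ∀ x, s x ∈ degGE Y 1) : subst s 1 = 1 := by
  simpa using subst_prod_map_var hs []

theorem subst_var {s : X → NCSeries Y} (hs : ∀ x, s x ∈ degGE Y 1) (x : X) :
    subst s (var x) = s x := by
  simpa using subst_prod_map_var hs [x]

/-- Substitution of series without constant term as a morphism of algebras. -/
noncomputable def substHom (s : X → NCSeries Y) (hs : ∀ x, s x ∈ degGE Y 1) :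
    NCSeries X →ₐ[ℂ] NCSeries Y :=
  AlgHom.ofLinearMap (substLinear s) (subst_one hs) (subst_mul hs)

theorem substHom_apply {s : X → NCSeries Y} (hs : ∀ x, s x ∈ degGE Y 1) (f : NCSeries X) :
    substHom s hs f = subst s f := rfl

theorem subst_evalPS {s : X → NCSeries Y} (hs : ∀ x, s x ∈ degGE Y 1) {a : NCSeries X}
    (ha : a ∈ degGE X 1) (p : PowerSeries ℂ) : subst s (evalPS a p) = evalPS (subst s a) p := by
  ext w
  have h1 := subst_mem_degGE s (evalPS_sub_aeval_mem ha p (w.length + 1))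
  rw [← substHom_apply hs, map_sub, ← Polynomial.aeval_algHom_apply] at h1
  rw [← substHom_apply hs, coeff_eq_of_sub_mem h1 (by omega)]
  rfl

theorem subst_rpow {s : X → NCSeries Y} (hs : ∀ x, s x ∈ degGE Y 1) {a : NCSeries X}
    (ha : a ∈ degGE X 1) (t : ℝ) : subst s (rpow t a) = rpow t (subst s a) := by
  rw [rpow, rpow, exp_smul_eq_evalPS, exp_smul_eq_evalPS, subst_evalPS hs ha]

end Subst

/-! ### The topology of coefficientwise convergence -/

/-- The topology of coefficientwise convergence. -/
noncomputable instance instTopologicalSpace (X : Type) : TopologicalSpace (NCSeries X) :=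
  inferInstanceAs (TopologicalSpace (List X → ℂ))

theorem tendsto_nhds_iff {ι : Type*} {l : Filter ι} {F : ι → NCSeries X} {f : NCSeries X} :
    Filter.Tendsto F l (nhds f) ↔
      ∀ w, Filter.Tendsto (fun i => coeff w (F i)) l (nhds (coeff w f)) :=
  tendsto_pi_nhds

theorem continuous_coeff (w : List X) : Continuous (coeff w : NCSeries X → ℂ) :=
  continuous_apply w

theorem continuous_iff {Z : Type*} [TopologicalSpace Z] {F : Z → NCSeries X} :
    Continuous F ↔ ∀ w, Continuous fun z => coeff w (F z) :=
  continuous_pi_iff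

instance instContinuousMul (X : Type) : ContinuousMul (NCSeries X) where
  continuous_mul := by
    rw [continuous_iff]
    intro w
    simp only [coeff_mul]
    exact continuous_finsetSum _ fun p _ =>
      ((continuous_coeff _).comp continuous_fst).mul ((continuous_coeff _).comp continuous_snd)

instance instContinuousAdd (X : Type) : ContinuousAdd (NCSeries X) :=
  inferInstanceAs (ContinuousAdd (List X → ℂ))

theorem continuous_subst [Fintype X] (s : X → NCSeries Y) : Continuous (subst s) := by
  rw [continuous_iff]
  intro w
  simp only [coeff_subst]
  exact continuous_finsetSum _ fun k _ => continuous_finsetSum _ fun v _ =>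
    (continuous_coeff _).mul continuous_const

theorem continuous_exp_smul (a : NCSeries X) : Continuous fun c : ℂ => exp (c • a) := by
  rw [continuous_iff]
  intro w
  simp only [coeff_exp_smul]
  fun_prop

theorem tendsto_rpow_one {ι : Type*} {l : Filter ι} {t : ι → ℝ}
    (ht : Filter.Tendsto t l (nhds 1)) (a : NCSeries X) :
    Filter.Tendsto (fun i => rpow (t i) a) l (nhds 1) := by
  have h1 : Filter.Tendsto (fun i => (Real.log (t i) : ℂ)) l (nhds ((0 : ℝ) : ℂ)) := by
    have := (Real.continuousAt_log one_ne_zero).tendsto.comp ht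
    rw [Real.log_one] at this
    exact (Complex.continuous_ofReal.tendsto 0).comp this
  have h2 := ((continuous_exp_smul a).tendsto ((0 : ℝ) : ℂ)).comp h1
  rwa [Complex.ofReal_zero, zero_smul, exp_zero] at h2

/-- The normalization by an asymptotic behaviour pins down the right multiplier: if `K R` and
`K C R` both tend to `1`, then the term of lowest degree of `C - 1` would survive in the limit
of `K (C - 1) R`, so that it vanishes. -/
theorem eq_one_of_tendsto {ι : Type*} {l : Filter ι} [l.NeBot] {K R : ι → NCSeries X}
    {C : NCSeries X} (h : Filter.Tendsto (fun i => K i * R i) l (nhds 1))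
    (hC : Filter.Tendsto (fun i => K i * C * R i) l (nhds 1)) : C = 1 := by
  have hk : ∀ k, C - 1 ∈ degGE X k := by
    intro k
    induction k with
    | zero => exact mem_degGE_zero _
    | succ k ih =>
      intro w hw
      rcases Nat.lt_succ_iff_lt_or_eq.1 hw with hw | hw
      · exact ih w hw
      have e : ∀ i, coeff [] (K i * R i) * coeff w (C - 1) =
          coeff w (K i * C * R i) - coeff w (K i * R i) := by
        intro i
        rw [← coeff_sub, coeff_nil_mul, mul_right_comm, ← coeff_mul_mul_of_length_eq ih hw]
        congr 1
        noncomm_ring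
      have h1 := (tendsto_nhds_iff.1 h []).mul_const (coeff w (C - 1))
      have h2 := (tendsto_nhds_iff.1 hC w).sub (tendsto_nhds_iff.1 h w)
      simp only [e] at h1
      have := tendsto_nhds_unique h1 h2
      rwa [coeff_nil_one, one_mul, sub_self] at this
  ext w
  exact coeff_eq_of_sub_mem (hk (w.length + 1)) (by omega)

end NCSeries

open NCSeries

variable {X Y : Type}

/-! ### Uniqueness of solutions and of holonomies -/

/-- A solution of a linear equation `D' = ω D` whose `ω` has no constant term vanishes as soon as
it vanishes at one point: by induction on the degree, the derivative of each coefficient is zero. -/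
theorem eq_zero_of_hasDerivAt {ω D : ℝ → NCSeries X}
    (hω : ∀ u ∈ Set.Ioo (0 : ℝ) 1, ω u ∈ degGE X 1)
    (hD : ∀ u ∈ Set.Ioo (0 : ℝ) 1, ∀ w : List X,
      HasDerivAt (fun t => coeff w (D t)) (coeff w (ω u * D u)) u)
    {u₀ : ℝ} (hu₀ : u₀ ∈ Set.Ioo (0 : ℝ) 1) (h0 : D u₀ = 0) :
    ∀ u ∈ Set.Ioo (0 : ℝ) 1, D u = 0 := by
  have hn : ∀ n, ∀ u ∈ Set.Ioo (0 : ℝ) 1, D u ∈ degGE X n := by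
    intro n
    induction n with
    | zero => exact fun u _ => mem_degGE_zero _
    | succ n ih =>
      intro u hu w hw
      have hd : ∀ t ∈ Set.Ioo (0 : ℝ) 1, HasDerivAt (fun t => coeff w (D t)) 0 t := by
        intro t ht
        have := hD t ht w
        rwa [mul_mem_degGE (hω t ht) (ih t ht) w (by omega)] at this
      have := isOpen_Ioo.is_const_of_deriv_eq_zero (isPreconnected_Ioo)
        (fun t ht => (hd t ht).differentiableAt.differentiableWithinAt)
        (fun t ht => (hd t ht).deriv) hu hu₀
      simpa only [h0, coeff_zero] using this
  intro u hu
  ext w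
  exact hn (w.length + 1) u hu w (by omega)

theorem hasDerivAt_coeff_mul_const {F : ℝ → NCSeries X} {F' : NCSeries X} {u : ℝ}
    (h : ∀ w : List X, HasDerivAt (fun t => coeff w (F t)) (coeff w F') u) (C : NCSeries X)
    (w : List X) : HasDerivAt (fun t => coeff w (F t * C)) (coeff w (F' * C)) u := by
  simp only [coeff_mul]
  exact HasDerivAt.fun_sum fun p _ => (h _).mul_const _

theorem IsSolution.mul_const {ω : ℝ → NCSeries X} {G : ℝ → (NCSeries X)ˣ} (h : IsSolution ω G)
    (C : (NCSeries X)ˣ) : IsSolution ω (fun u => G u * C) := by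
  intro u hu w
  have := hasDerivAt_coeff_mul_const (h u hu) (C : NCSeries X) w
  rwa [mul_assoc] at this

/-- Two solutions differ by a constant right factor. -/
theorem IsSolution.exists_eq_mul {ω : ℝ → NCSeries X}
    (hω : ∀ u ∈ Set.Ioo (0 : ℝ) 1, ω u ∈ degGE X 1) {G G' : ℝ → (NCSeries X)ˣ}
    (h : IsSolution ω G) (h' : IsSolution ω G') :
    ∃ C : (NCSeries X)ˣ, ∀ u ∈ Set.Ioo (0 : ℝ) 1, G' u = G u * C := by
  refine ⟨(G (1 / 2))⁻¹ * G' (1 / 2), fun u hu => ?_⟩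
  have h1 := h.mul_const ((G (1 / 2))⁻¹ * G' (1 / 2))
  have h2 := eq_zero_of_hasDerivAt (u₀ := 1 / 2)
    (D := fun t => (G' t : NCSeries X) -
      ((G t * ((G (1 / 2))⁻¹ * G' (1 / 2)) : (NCSeries X)ˣ) : NCSeries X)) hω ?_
    (by norm_num) (by simp) u hu
  · exact Units.ext (sub_eq_zero.1 h2)
  · intro t ht w
    have := (h' t ht w).fun_sub (h1 t ht w)
    rw [mul_sub, coeff_sub]
    simpa only [coeff_sub] using this

theorem isAsympZero_iff {a : NCSeries X} {G : ℝ → (NCSeries X)ˣ} :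
    IsAsympZero a G ↔ Filter.Tendsto (fun u : ℝ => (G u : NCSeries X) * rpow u (-a))
      (nhdsWithin 0 (Set.Ioi 0)) (nhds 1) :=
  tendsto_nhds_iff.symm

theorem isAsympOne_iff {b : NCSeries X} {G : ℝ → (NCSeries X)ˣ} :
    IsAsympOne b G ↔ Filter.Tendsto (fun u : ℝ => (G u : NCSeries X) * rpow (1 - u) (-b))
      (nhdsWithin 1 (Set.Iio 1)) (nhds 1) :=
  tendsto_nhds_iff.symm

theorem eventually_nhdsGT_zero : ∀ᶠ u : ℝ in nhdsWithin 0 (Set.Ioi 0), u ∈ Set.Ioo (0 : ℝ) 1 :=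
  Ioo_mem_nhdsGT one_pos

theorem eventually_nhdsLT_one : ∀ᶠ u : ℝ in nhdsWithin 1 (Set.Iio 1), u ∈ Set.Ioo (0 : ℝ) 1 :=
  Ioo_mem_nhdsLT one_pos

/-- Two solutions with the same normalized behaviour along a filter on `]0,1[` agree there. -/
theorem IsSolution.eq_of_tendsto {ω : ℝ → NCSeries X}
    (hω : ∀ u ∈ Set.Ioo (0 : ℝ) 1, ω u ∈ degGE X 1) {G G' : ℝ → (NCSeries X)ˣ}
    (h : IsSolution ω G) (h' : IsSolution ω G') {l : Filter ℝ} [l.NeBot]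
    (hl : ∀ᶠ u in l, u ∈ Set.Ioo (0 : ℝ) 1) {R : ℝ → NCSeries X}
    (hR : Filter.Tendsto (fun u => (G u : NCSeries X) * R u) l (nhds 1))
    (hR' : Filter.Tendsto (fun u => (G' u : NCSeries X) * R u) l (nhds 1)) :
    ∀ u ∈ Set.Ioo (0 : ℝ) 1, G' u = G u := by
  obtain ⟨C, hC⟩ := h.exists_eq_mul hω h'
  have h1 : (C : NCSeries X) = 1 := by
    refine eq_one_of_tendsto hR (hR'.congr' ?_)
    filter_upwards [hl] with u hu
    rw [hC u hu, Units.val_mul]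
  intro u hu
  rw [hC u hu, show C = 1 from Units.ext h1, mul_one]

theorem IsRenormalizedHolonomy.unique {ω : ℝ → NCSeries X}
    (hω : ∀ u ∈ Set.Ioo (0 : ℝ) 1, ω u ∈ degGE X 1) {a b P P' : NCSeries X}
    (h : IsRenormalizedHolonomy ω a b P) (h' : IsRenormalizedHolonomy ω a b P') : P' = P := by
  obtain ⟨G₀, G₁, s₀, a₀, s₁, a₁, hP⟩ := h
  obtain ⟨G₀', G₁', s₀', a₀', s₁', a₁', hP'⟩ := h'
  have hu : (1 / 2 : ℝ) ∈ Set.Ioo (0 : ℝ) 1 := by norm_num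
  have e₀ := s₀.eq_of_tendsto hω s₀' eventually_nhdsGT_zero (isAsympZero_iff.1 a₀)
    (isAsympZero_iff.1 a₀') _ hu
  have e₁ := s₁.eq_of_tendsto hω s₁' eventually_nhdsLT_one (isAsympOne_iff.1 a₁)
    (isAsympOne_iff.1 a₁') _ hu
  rw [hP _ hu, hP' _ hu, e₀, e₁]

theorem exists_isRenormalizedHolonomy {ω : ℝ → NCSeries X}
    (hω : ∀ u ∈ Set.Ioo (0 : ℝ) 1, ω u ∈ degGE X 1) {a b : NCSeries X}
    {G₀ G₁ : ℝ → (NCSeries X)ˣ} (s₀ : IsSolution ω G₀) (a₀ : IsAsympZero a G₀)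
    (s₁ : IsSolution ω G₁) (a₁ : IsAsympOne b G₁) :
    ∃ P, IsRenormalizedHolonomy ω a b P := by
  obtain ⟨C, hC⟩ := s₁.exists_eq_mul hω s₀
  refine ⟨C, G₀, G₁, s₀, a₀, s₁, a₁, fun u hu => ?_⟩
  rw [hC u hu, Units.val_mul, Units.inv_mul_cancel_left]

/-- Substitution of series without constant term carries holonomies to holonomies. -/
theorem IsRenormalizedHolonomy.subst [Fintype X] [DecidableEq X] {ω : ℝ → NCSeries X}
    {a b P : NCSeries X} (ha : a ∈ degGE X 1) (hb : b ∈ degGE X 1)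
    (h : IsRenormalizedHolonomy ω a b P) {s : X → NCSeries Y} (hs : ∀ x, s x ∈ degGE Y 1) :
    IsRenormalizedHolonomy (fun u => NCSeries.subst s (ω u)) (NCSeries.subst s a)
      (NCSeries.subst s b) (NCSeries.subst s P) := by
  obtain ⟨G₀, G₁, s₀, a₀, s₁, a₁, hP⟩ := h
  set φ : (NCSeries X)ˣ →* (NCSeries Y)ˣ := Units.map (substHom s hs : NCSeries X →* NCSeries Y)
  have hφ : ∀ g : (NCSeries X)ˣ, (φ g : NCSeries Y) = NCSeries.subst s g := fun _ => rfl
  have hsol : ∀ G : ℝ → (NCSeries X)ˣ, IsSolution ω G →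
      IsSolution (fun u => NCSeries.subst s (ω u)) (fun u => φ (G u)) := by
    intro G hG u hu w
    simp only [hφ]
    rw [← subst_mul hs]
    simp only [coeff_subst]
    exact HasDerivAt.fun_sum fun k _ => HasDerivAt.fun_sum fun v _ =>
      (hG u hu _).mul_const _
  have hneg : ∀ c : NCSeries X, -NCSeries.subst s c = NCSeries.subst s (-c) :=
    fun c => ((substLinear s).map_neg c).symm
  have hasy : ∀ (G : ℝ → (NCSeries X)ˣ) (t : ℝ → ℝ) (c : NCSeries X) (l : Filter ℝ),
      c ∈ degGE X 1 →
      Filter.Tendsto (fun u => (G u : NCSeries X) * rpow (t u) (-c)) l (nhds 1) →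
      Filter.Tendsto (fun u => (φ (G u) : NCSeries Y) * rpow (t u) (-NCSeries.subst s c)) l
        (nhds 1) := by
    intro G t c l hc h
    have := ((continuous_subst s).tendsto 1).comp h
    rw [subst_one hs] at this
    refine this.congr fun u => ?_
    rw [Function.comp_apply, subst_mul hs, subst_rpow hs (neg_mem hc), hneg, hφ]
  refine ⟨fun u => φ (G₀ u), fun u => φ (G₁ u), hsol _ s₀,
    isAsympZero_iff.2 (hasy _ _ _ _ ha (isAsympZero_iff.1 a₀)), hsol _ s₁,
    isAsympOne_iff.2 (hasy _ _ _ _ hb (isAsympOne_iff.1 a₁)), fun u hu => ?_⟩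
  rw [hP u hu, ← Units.val_mul, ← hφ, map_mul, map_inv, Units.val_mul]

/-! ### Existence of the solution with prescribed behaviour at the origin -/

/-- `h(t) = O(t ^ s)` on each interval `]0, c]` with `c < 1`. -/
def IsBoundedByRpow (s : ℝ) (h : ℝ → ℂ) : Prop :=
  ∀ c < (1 : ℝ), ∃ C : ℝ, ∀ t ∈ Set.Ioc 0 c, ‖h t‖ ≤ C * t ^ s

namespace IsBoundedByRpow

theorem mul {s s' : ℝ} {h h' : ℝ → ℂ} (H : IsBoundedByRpow s h) (H' : IsBoundedByRpow s' h') :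
    IsBoundedByRpow (s + s') (fun t => h t * h' t) := by
  intro c hc
  obtain ⟨C, hC⟩ := H c hc
  obtain ⟨C', hC'⟩ := H' c hc
  refine ⟨C * C', fun t ht => ?_⟩
  rw [norm_mul, Real.rpow_add ht.1, mul_mul_mul_comm]
  exact mul_le_mul (hC t ht) (hC' t ht) (norm_nonneg _) ((norm_nonneg _).trans (hC t ht))

theorem mono {s s' : ℝ} (hs : s' ≤ s) {h : ℝ → ℂ} (H : IsBoundedByRpow s h) :
    IsBoundedByRpow s' h := by
  intro c hc
  obtain ⟨C, hC⟩ := H c hc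
  refine ⟨|C|, fun t ht => (hC t ht).trans ?_⟩
  have h1 : t ^ s ≤ t ^ s' := Real.rpow_le_rpow_of_exponent_ge ht.1 (ht.2.trans hc.le) hs
  exact mul_le_mul (le_abs_self C) h1 (Real.rpow_nonneg ht.1.le _) (abs_nonneg C)

theorem of_continuousOn {h : ℝ → ℂ} (hh : ContinuousOn h (Set.Ico 0 1)) :
    IsBoundedByRpow 0 h := by
  intro c hc
  obtain ⟨C, hC⟩ := isCompact_Icc.exists_bound_of_continuousOn
    (hh.mono (Set.Icc_subset_Ico_right hc : Set.Icc 0 c ⊆ _))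
  refine ⟨C, fun t ht => ?_⟩
  rw [Real.rpow_zero, mul_one]
  exact hC t ⟨ht.1.le, ht.2⟩

theorem log_pow (n : ℕ) : IsBoundedByRpow (-1 / 2) (fun t => (Real.log t : ℂ) ^ n) := by
  intro c hc
  refine ⟨(2 * (n + 1)) ^ n, fun t ht => ?_⟩
  -- `|log t| * t ^ r ≤ 1 / r` with `r = 1 / (2 (n + 1))`, raised to the power `n`
  have h1 := Real.abs_log_mul_self_rpow_lt t (1 / (2 * (n + 1))) ht.1 (ht.2.trans hc.le)
    (by positivity)
  rw [one_div_one_div] at h1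
  have h2 : (|Real.log t| * t ^ (1 / (2 * (n + 1)) : ℝ)) ^ n ≤ (2 * (n + 1)) ^ n := by
    refine pow_le_pow_left₀ (by have := ht.1; positivity) ?_ n
    rw [abs_mul, abs_of_nonneg (Real.rpow_nonneg ht.1.le _)] at h1
    exact h1.le
  have h3 : t ^ (1 / 2 : ℝ) ≤ (t ^ (1 / (2 * (n + 1)) : ℝ)) ^ n := by
    rw [← Real.rpow_natCast, ← Real.rpow_mul ht.1.le]
    refine Real.rpow_le_rpow_of_exponent_ge ht.1 (ht.2.trans hc.le) ?_
    have : (0 : ℝ) < n + 1 := by positivity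
    rw [div_mul_eq_mul_div, div_le_div_iff₀ (by positivity) (by positivity)]
    linarith
  have h4 : ‖(Real.log t : ℂ) ^ n‖ = |Real.log t| ^ n := by
    rw [norm_pow, Complex.norm_real, Real.norm_eq_abs]
  have h5 : |Real.log t| ^ n * t ^ (1 / 2 : ℝ) ≤ (2 * (n + 1)) ^ n := by
    refine le_trans ?_ h2
    rw [mul_pow]
    gcongr
  rw [h4, neg_div, Real.rpow_neg ht.1.le, ← div_eq_mul_inv,
    le_div_iff₀ (Real.rpow_pos_of_pos ht.1 _)]
  exact h5

theorem inv : IsBoundedByRpow (-1) (fun t => (t : ℂ)⁻¹) := by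
  intro c _
  refine ⟨1, fun t ht => ?_⟩
  rw [norm_inv, Complex.norm_real, Real.norm_of_nonneg ht.1.le, one_mul, Real.rpow_neg_one]

theorem congr {s : ℝ} {h h' : ℝ → ℂ} (H : IsBoundedByRpow s h)
    (e : ∀ t ∈ Set.Ioo (0 : ℝ) 1, h' t = h t) : IsBoundedByRpow s h' := by
  intro c hc
  obtain ⟨C, hC⟩ := H c hc
  exact ⟨C, fun t ht => by rw [e t ⟨ht.1, ht.2.trans_lt hc⟩]; exact hC t ht⟩

theorem intervalIntegrable {h : ℝ → ℂ} (H : IsBoundedByRpow (-1 / 2) h)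
    (hh : ContinuousOn h (Set.Ioo 0 1)) {u : ℝ} (hu : u ∈ Set.Ioo (0 : ℝ) 1) :
    IntervalIntegrable h MeasureTheory.volume 0 u := by
  obtain ⟨C, hC⟩ := H u hu.2
  refine ((intervalIntegral.intervalIntegrable_rpow' (r := -1 / 2) (by norm_num)).const_mul
    C).mono_fun' ?_ ?_
  · rw [Set.uIoc_of_le hu.1.le]
    exact (hh.mono fun t ht => ⟨ht.1, ht.2.trans_lt hu.2⟩).aestronglyMeasurable measurableSet_Ioc
  · rw [Set.uIoc_of_le hu.1.le]
    exact (MeasureTheory.ae_restrict_mem measurableSet_Ioc).mono hC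

theorem hasDerivAt_integral {h : ℝ → ℂ} (H : IsBoundedByRpow (-1 / 2) h)
    (hh : ContinuousOn h (Set.Ioo 0 1)) {u : ℝ} (hu : u ∈ Set.Ioo (0 : ℝ) 1) :
    HasDerivAt (fun u => ∫ t in (0 : ℝ)..u, h t) (h u) u :=
  intervalIntegral.integral_hasDerivAt_right (H.intervalIntegrable hh hu)
    (hh.stronglyMeasurableAtFilter isOpen_Ioo u hu) (hh.continuousAt (isOpen_Ioo.mem_nhds hu))

theorem integral {h : ℝ → ℂ} (H : IsBoundedByRpow (-1 / 2) h) :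
    IsBoundedByRpow (1 / 2) (fun u => ∫ t in (0 : ℝ)..u, h t) := by
  intro c hc
  obtain ⟨C, hC⟩ := H c hc
  refine ⟨2 * C, fun u hu => ?_⟩
  have h1 : ‖∫ t in (0 : ℝ)..u, h t‖ ≤ ∫ t in (0 : ℝ)..u, C * t ^ (-1 / 2 : ℝ) :=
    intervalIntegral.norm_integral_le_of_norm_le hu.1.le
      (Filter.Eventually.of_forall fun t ht => hC t ⟨ht.1, ht.2.trans hu.2⟩)
      ((intervalIntegral.intervalIntegrable_rpow' (by norm_num)).const_mul C)
  refine h1.trans (le_of_eq ?_)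
  rw [intervalIntegral.integral_const_mul, integral_rpow (Or.inl (by norm_num))]
  norm_num
  ring

end IsBoundedByRpow

section Existence

variable [DecidableEq X]

/-- The coefficients of the solution of `G' = (∑ f x • x) G` with `G(u) ≃ u ^ a` at the origin,
where `f a` is `1 / u` and the other `f x` are regular at `0`. The words that are powers of the
letter `a` have the coefficients of `u ^ a`; the coefficient of any other word is the integral
from `0` that the equation calls for, which converges. -/
noncomputable def originCoeff (a : X) (f : X → ℝ → ℂ) : List X → ℝ → ℂ
  | [] => fun _ => 1
  | x :: w => if ∀ y ∈ x :: w, y = a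
      then fun u => (Real.log u : ℂ) ^ (w.length + 1) * ((w.length + 1).factorial : ℂ)⁻¹
      else fun u => ∫ t in (0 : ℝ)..u, f x t * originCoeff a f w t

theorem originCoeff_of_forall_eq {a : X} (f : X → ℝ → ℂ) {w : List X} (hw : ∀ y ∈ w, y = a)
    (u : ℝ) : originCoeff a f w u = (Real.log u : ℂ) ^ w.length * (w.length.factorial : ℂ)⁻¹ := by
  cases w with
  | nil => simp [originCoeff]
  | cons x w => rw [originCoeff, if_pos hw, List.length_cons]

theorem originCoeff_of_not_forall_eq {a x : X} (f : X → ℝ → ℂ) {w : List X}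
    (hw : ¬∀ y ∈ x :: w, y = a) :
    originCoeff a f (x :: w) = fun u => ∫ t in (0 : ℝ)..u, f x t * originCoeff a f w t := by
  rw [originCoeff, if_neg hw]

theorem coeff_rpow_var (a : X) (u : ℝ) (w : List X) :
    coeff w (rpow u (var a)) =
      if ∀ y ∈ w, y = a then (Real.log u : ℂ) ^ w.length * (w.length.factorial : ℂ)⁻¹ else 0 := by
  rw [rpow, coeff_exp_smul]
  simp only [coeff_var_pow]
  split_ifs with hw
  · rw [Finset.sum_eq_single w.length]
    · rw [if_pos (List.eq_replicate_iff.2 ⟨rfl, hw⟩), mul_one]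
    · intro k _ hk
      rw [if_neg (fun e => hk (by rw [e, List.length_replicate])), mul_zero, mul_zero]
    · simp
  · refine Finset.sum_eq_zero fun k _ => ?_
    rw [if_neg, mul_zero, mul_zero]
    rintro rfl
    exact hw fun y hy => List.eq_of_mem_replicate hy

variable {a : X} {f : X → ℝ → ℂ}

/-- Analytic properties of `originCoeff`, by induction on the word. Integrals are only taken for
words other than the powers of `a`, and then the integrand is `O(t ^ (-1/2))`: either the new
letter is `a` and the previous coefficient is `O(t ^ (1/2))`, or the new letter has a regular
coefficient and the previous one grows at most like a power of `log t`. -/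
theorem originCoeff_spec (hfa : ∀ t ∈ Set.Ioo (0 : ℝ) 1, f a t = (t : ℂ)⁻¹)
    (hf : ∀ x ≠ a, ContinuousOn (f x) (Set.Ico 0 1)) (w : List X) :
    ContinuousOn (originCoeff a f w) (Set.Ioo 0 1) ∧
    IsBoundedByRpow (-1 / 2) (originCoeff a f w) ∧
    ((¬∀ y ∈ w, y = a) → IsBoundedByRpow (1 / 2) (originCoeff a f w)) ∧
    ∀ x, ∀ u ∈ Set.Ioo (0 : ℝ) 1,
      HasDerivAt (originCoeff a f (x :: w)) (f x u * originCoeff a f w u) u := by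
  have hfc : ∀ x, ContinuousOn (f x) (Set.Ioo 0 1) := by
    intro x
    by_cases hx : x = a
    · subst hx
      refine ContinuousOn.congr ?_ hfa
      exact Complex.continuous_ofReal.continuousOn.inv₀ fun t ht => by
        exact_mod_cast ht.1.ne'
    · exact (hf x hx).mono Set.Ioo_subset_Ico_self
  have hderiv : ∀ w, ContinuousOn (originCoeff a f w) (Set.Ioo 0 1) →
      IsBoundedByRpow (-1 / 2) (originCoeff a f w) →
      ((¬∀ y ∈ w, y = a) → IsBoundedByRpow (1 / 2) (originCoeff a f w)) →
      ∀ x, ((¬∀ y ∈ x :: w, y = a) →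
        IsBoundedByRpow (-1 / 2) (fun t => f x t * originCoeff a f w t)) ∧
        ∀ u ∈ Set.Ioo (0 : ℝ) 1,
          HasDerivAt (originCoeff a f (x :: w)) (f x u * originCoeff a f w u) u := by
    intro w hc hb hb' x
    have hB : (¬∀ y ∈ x :: w, y = a) →
        IsBoundedByRpow (-1 / 2) (fun t => f x t * originCoeff a f w t) := by
      intro hw
      by_cases hx : x = a
      · subst hx
        have hw' : ¬∀ y ∈ w, y = x := fun h => hw (by simpa using h)
        have := (IsBoundedByRpow.inv.congr hfa).mul (hb' hw')
        norm_num at this ⊢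
        exact this
      · have := (IsBoundedByRpow.of_continuousOn (hf x hx)).mul hb
        rwa [zero_add] at this
    refine ⟨hB, fun u hu => ?_⟩
    by_cases hw : ∀ y ∈ x :: w, y = a
    · have hx : x = a := hw x (by simp)
      subst hx
      have e : originCoeff x f (x :: w) = fun u =>
          (Real.log u : ℂ) ^ (w.length + 1) * ((w.length + 1).factorial : ℂ)⁻¹ := by
        rw [originCoeff, if_pos hw]
      rw [e, originCoeff_of_forall_eq f (fun y hy => hw y (List.mem_cons_of_mem _ hy)), hfa u hu]
      have h1 : HasDerivAt (fun t : ℝ => (Real.log t : ℂ)) ((u⁻¹ : ℝ) : ℂ) u :=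
        (Real.hasDerivAt_log hu.1.ne').ofReal_comp
      have h2 := (h1.fun_pow (w.length + 1)).mul_const ((w.length + 1).factorial : ℂ)⁻¹
      refine h2.congr_deriv ?_
      have h3 : (w.length.factorial : ℂ) ≠ 0 := by exact_mod_cast w.length.factorial_ne_zero
      have h4 : (w.length + 1 : ℂ) ≠ 0 := by exact_mod_cast w.length.succ_ne_zero
      rw [Nat.factorial_succ]
      push_cast
      field_simp
    · rw [originCoeff_of_not_forall_eq f hw]
      exact (hB hw).hasDerivAt_integral ((hfc x).mul hc) hu
  induction w with
  | nil =>
    have h1 : ContinuousOn (originCoeff a f []) (Set.Ioo 0 1) := continuousOn_const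
    have h2 : IsBoundedByRpow (-1 / 2) (originCoeff a f []) := by
      have : IsBoundedByRpow (-1 / 2) (fun _ => 1) := by simpa using IsBoundedByRpow.log_pow 0
      exact this
    have h3 : (¬∀ y ∈ ([] : List X), y = a) → IsBoundedByRpow (1 / 2) (originCoeff a f []) :=
      fun h => absurd (by simp) h
    exact ⟨h1, h2, h3, fun x => (hderiv _ h1 h2 h3 x).2⟩
  | cons x w ih =>
    obtain ⟨h1, h2, h3, h4⟩ := ih
    have h1' : ContinuousOn (originCoeff a f (x :: w)) (Set.Ioo 0 1) :=
      fun u hu => (h4 x u hu).continuousAt.continuousWithinAt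
    have h3' : (¬∀ y ∈ x :: w, y = a) → IsBoundedByRpow (1 / 2) (originCoeff a f (x :: w)) := by
      intro hw
      rw [originCoeff_of_not_forall_eq f hw]
      exact ((hderiv w h1 h2 h3 x).1 hw).integral
    have h2' : IsBoundedByRpow (-1 / 2) (originCoeff a f (x :: w)) := by
      by_cases hw : ∀ y ∈ x :: w, y = a
      · have := (IsBoundedByRpow.log_pow (x :: w).length).mul
          (IsBoundedByRpow.of_continuousOn
            (continuousOn_const (c := ((x :: w).length.factorial : ℂ)⁻¹)))
        rw [add_zero] at this
        exact this.congr fun t _ => originCoeff_of_forall_eq f hw t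
      · exact (h3' hw).mono (by norm_num)
    exact ⟨h1', h2', h3', fun y => (hderiv _ h1' h2' h3' y).2⟩

theorem IsBoundedByRpow.tendsto_mul_log_pow {h : ℝ → ℂ} (H : IsBoundedByRpow (1 / 2) h) (n : ℕ) :
    Filter.Tendsto (fun u => h u * (Real.log u : ℂ) ^ n) (nhdsWithin 0 (Set.Ioi 0)) (nhds 0) := by
  obtain ⟨C, hC⟩ := H (1 / 2) (by norm_num)
  have h1 : Asymptotics.IsBigO (nhdsWithin 0 (Set.Ioi 0)) h (fun t : ℝ => t ^ (1 / 2 : ℝ)) := by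
    refine Asymptotics.IsBigO.of_bound C ?_
    filter_upwards [Ioc_mem_nhdsGT (show (0 : ℝ) < 1 / 2 by norm_num)] with t ht
    rw [Real.norm_of_nonneg (Real.rpow_nonneg ht.1.le _)]
    exact hC t ht
  have h2 : Asymptotics.IsLittleO (nhdsWithin 0 (Set.Ioi 0))
      (fun t : ℝ => (Real.log t : ℂ) ^ n) (fun t : ℝ => t ^ (-1 / 2 : ℝ)) := by
    refine Asymptotics.IsLittleO.of_norm_left ?_
    refine (isLittleO_abs_log_rpow_rpow_nhdsGT_zero n (by norm_num)).congr_left fun t => ?_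
    rw [norm_pow, Complex.norm_real, Real.norm_eq_abs, Real.rpow_natCast]
  have h3 := h1.mul_isLittleO h2
  refine (Asymptotics.isLittleO_one_iff ℝ).1 (h3.congr' Filter.EventuallyEq.rfl ?_)
  filter_upwards [self_mem_nhdsWithin] with t ht
  rw [← Real.rpow_add ht]
  norm_num

variable [Fintype X]

/-- Existence at a regular singular point at the origin. -/
theorem exists_isSolution_isAsympZero
    (hfa : ∀ t ∈ Set.Ioo (0 : ℝ) 1, f a t = (t : ℂ)⁻¹)
    (hf : ∀ x ≠ a, ContinuousOn (f x) (Set.Ico 0 1)) :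
    ∃ G : ℝ → (NCSeries X)ˣ, IsSolution (fun u => ∑ x, f x u • var x) G ∧
      IsAsympZero (var a) G := by
  have hunit : ∀ u, ∃ g : (NCSeries X)ˣ, (g : NCSeries X) = fun w => originCoeff a f w u :=
    fun u => isUnit_of_coeff_nil_eq_one (f := fun w => originCoeff a f w u) rfl
  choose G hG using hunit
  have hcoeff : ∀ w u, coeff w (G u : NCSeries X) = originCoeff a f w u := by
    intro w u
    rw [hG]
    rfl
  refine ⟨G, fun u hu w => ?_, ?_⟩
  · simp only [hcoeff]
    rw [Finset.sum_mul, coeff_sum]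
    cases w with
    | nil =>
      have : ∀ x, coeff [] (f x u • var x * (G u : NCSeries X)) = 0 := fun x => by
        rw [smul_mul_assoc, coeff_smul, coeff_nil_var_mul, mul_zero]
      simp only [this, Finset.sum_const_zero]
      exact hasDerivAt_const u (1 : ℂ)
    | cons y w =>
      have : ∀ x, coeff (y :: w) (f x u • var x * (G u : NCSeries X)) =
          if y = x then f x u * originCoeff a f w u else 0 := fun x => by
        rw [smul_mul_assoc, coeff_smul, coeff_cons_var_mul, hcoeff, mul_ite, mul_zero]
      simp only [this]
      rw [Finset.sum_ite_eq, if_pos (Finset.mem_univ _)]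
      exact (originCoeff_spec hfa hf w).2.2.2 y u hu
  · rw [isAsympZero_iff]
    have e : ∀ u : ℝ, (G u : NCSeries X) * rpow u (-var a) =
        ((G u : NCSeries X) - rpow u (var a)) * rpow u (-var a) + 1 := by
      intro u
      rw [sub_mul, rpow_mul_rpow_neg (var_mem_degGE_one a), sub_add_cancel]
    simp only [e]
    suffices h : Filter.Tendsto (fun u => ((G u : NCSeries X) - rpow u (var a)) *
        rpow u (-var a)) (nhdsWithin 0 (Set.Ioi 0)) (nhds 0) by
      have := Filter.Tendsto.add (M := NCSeries X) h (tendsto_const_nhds (x := 1))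
      rwa [zero_add] at this
    rw [tendsto_nhds_iff]
    intro w
    simp only [coeff_mul, coeff_zero]
    rw [← Finset.sum_const_zero (M := ℂ) (s := Finset.HasAntidiagonal.antidiagonal w.length)]
    refine tendsto_finsetSum _ fun p _ => ?_
    generalize w.take p.1 = v
    generalize w.drop p.1 = v'
    simp only [coeff_sub, hcoeff, coeff_rpow_var]
    by_cases hv : ∀ y ∈ v, y = a
    · simp only [originCoeff_of_forall_eq f hv, if_pos hv, sub_self, zero_mul]
      exact tendsto_const_nhds
    · simp only [if_neg hv, sub_zero, rpow, coeff_exp_smul, Finset.mul_sum]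
      rw [← Finset.sum_const_zero (M := ℂ) (s := Finset.range (v'.length + 1))]
      refine tendsto_finsetSum _ fun k _ => ?_
      have := (((originCoeff_spec hfa hf v).2.2.1 hv).tendsto_mul_log_pow k).mul_const
        ((k.factorial : ℂ)⁻¹ * coeff v' ((-var a) ^ k))
      rw [zero_mul] at this
      exact this.congr fun u => by ring

/-- Existence at a regular singular point at `1`: reflect the interval. -/
theorem exists_isSolution_isAsympOne
    (hfa : ∀ t ∈ Set.Ioo (0 : ℝ) 1, f a t = ((t : ℂ) - 1)⁻¹)
    (hf : ∀ x ≠ a, ContinuousOn (f x) (Set.Ioc 0 1)) :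
    ∃ G : ℝ → (NCSeries X)ˣ, IsSolution (fun u => ∑ x, f x u • var x) G ∧
      IsAsympOne (var a) G := by
  obtain ⟨F, hF, hF0⟩ := exists_isSolution_isAsympZero (a := a) (f := fun x t => -f x (1 - t))
    (fun t ht => by
      rw [hfa (1 - t) ⟨by linarith [ht.2], by linarith [ht.1]⟩, ← inv_neg]
      push_cast
      ring_nf)
    (fun x hx => ((hf x hx).comp (continuous_const.sub continuous_id).continuousOn
      fun t ht => ⟨by simpa using ht.2, by simpa using ht.1⟩).neg)
  refine ⟨fun u => F (1 - u), fun u hu w => ?_, ?_⟩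
  · have h1 := hF (1 - u) ⟨by linarith [hu.2], by linarith [hu.1]⟩ w
    have h2 := h1.scomp u ((hasDerivAt_id u).const_sub 1)
    refine h2.congr_deriv ?_
    simp only [sub_sub_cancel, neg_smul, Finset.sum_neg_distrib, neg_mul, coeff_neg, one_smul,
      neg_neg]
  · rw [isAsympZero_iff] at hF0
    rw [isAsympOne_iff]
    refine hF0.comp (tendsto_nhdsWithin_iff.2 ⟨?_, ?_⟩)
    · have : Filter.Tendsto (fun u : ℝ => 1 - u) (nhds 1) (nhds (1 - 1)) :=
        (continuous_const.sub continuous_id).tendsto 1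
      rw [sub_self] at this
      exact this.mono_left nhdsWithin_le_nhds
    · filter_upwards [self_mem_nhdsWithin] with u hu
      exact sub_pos.2 (Set.mem_Iio.1 hu)

end Existence

/-! ### Existence and uniqueness of the two associators -/

theorem continuousOn_ofReal_sub_inv {c : ℝ} {S : Set ℝ} (h : ∀ t ∈ S, t ≠ c) :
    ContinuousOn (fun t : ℝ => ((t : ℂ) - c)⁻¹) S :=
  (Complex.continuous_ofReal.sub continuous_const).continuousOn.inv₀ fun t ht => by
    exact sub_ne_zero.2 (Complex.ofReal_injective.ne (h t ht))

theorem existsUnique_isKZAssociator : ∃! Φ : NCSeries (Fin 2), IsKZAssociator Φ := by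
  set f : Fin 2 → ℝ → ℂ := ![fun u => (u : ℂ)⁻¹, fun u => ((u : ℂ) - 1)⁻¹]
  have hω : (fun u : ℝ => ((u : ℂ)⁻¹) • var (0 : Fin 2) + (((u : ℂ) - 1)⁻¹) • var (1 : Fin 2)) =
      fun u => ∑ x, f x u • var x := by
    funext u
    simp [f, Fin.sum_univ_two]
  have h1 : ∀ u : ℝ, (∑ x, f x u • var x) ∈ degGE (Fin 2) 1 := fun u =>
    sum_mem fun x _ => Submodule.smul_mem _ _ (var_mem_degGE_one x)
  obtain ⟨G₀, s₀, a₀⟩ := exists_isSolution_isAsympZero (a := (0 : Fin 2)) (f := f)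
    (fun t _ => rfl) (fun x hx => by
      fin_cases x
      · exact absurd rfl hx
      · simpa [f] using continuousOn_ofReal_sub_inv (c := 1) (S := Set.Ico 0 1)
          fun t ht => ht.2.ne)
  obtain ⟨G₁, s₁, a₁⟩ := exists_isSolution_isAsympOne (a := (1 : Fin 2)) (f := f)
    (fun t _ => rfl) (fun x hx => by
      fin_cases x
      · simpa [f] using continuousOn_ofReal_sub_inv (c := 0) (S := Set.Ioc 0 1)
          fun t ht => ht.1.ne'
      · exact absurd rfl hx)
  unfold IsKZAssociator
  rw [hω]
  obtain ⟨P, hP⟩ := exists_isRenormalizedHolonomy (fun u _ => h1 u) s₀ a₀ s₁ a₁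
  exact ⟨P, hP, fun P' hP' => hP.unique (fun u _ => h1 u) hP'⟩

theorem existsUnique_isPsiTwo : ∃! Ψ : NCSeries (Fin 3), IsPsiTwo Ψ := by
  set f : Fin 3 → ℝ → ℂ :=
    ![fun z => (z : ℂ)⁻¹, fun z => ((z : ℂ) - 1)⁻¹, fun z => ((z : ℂ) + 1)⁻¹]
  have hω : (fun z : ℝ => ((z : ℂ)⁻¹) • var (0 : Fin 3) + (((z : ℂ) - 1)⁻¹) • var (1 : Fin 3) +
      (((z : ℂ) + 1)⁻¹) • var (2 : Fin 3)) = fun u => ∑ x, f x u • var x := by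
    funext u
    simp [f, Fin.sum_univ_three]
  have h1 : ∀ u : ℝ, (∑ x, f x u • var x) ∈ degGE (Fin 3) 1 := fun u =>
    sum_mem fun x _ => Submodule.smul_mem _ _ (var_mem_degGE_one x)
  obtain ⟨G₀, s₀, a₀⟩ := exists_isSolution_isAsympZero (a := (0 : Fin 3)) (f := f)
    (fun t _ => rfl) (fun x hx => by
      fin_cases x
      · exact absurd rfl hx
      · simpa [f] using continuousOn_ofReal_sub_inv (c := 1) (S := Set.Ico 0 1)
          fun t ht => ht.2.ne
      · simpa [f] using continuousOn_ofReal_sub_inv (c := -1) (S := Set.Ico 0 1)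
          fun t ht => by linarith [ht.1])
  obtain ⟨G₁, s₁, a₁⟩ := exists_isSolution_isAsympOne (a := (1 : Fin 3)) (f := f)
    (fun t _ => rfl) (fun x hx => by
      fin_cases x
      · simpa [f] using continuousOn_ofReal_sub_inv (c := 0) (S := Set.Ioc 0 1)
          fun t ht => ht.1.ne'
      · exact absurd rfl hx
      · simpa [f] using continuousOn_ofReal_sub_inv (c := -1) (S := Set.Ioc 0 1)
          fun t ht => by linarith [ht.1])
  unfold IsPsiTwo
  rw [hω]
  obtain ⟨P, hP⟩ := exists_isRenormalizedHolonomy (fun u _ => h1 u) s₀ a₀ s₁ a₁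
  exact ⟨P, hP, fun P' hP' => hP.unique (fun u _ => h1 u) hP'⟩

/-! ### The change of variable `u = 2 z / (1 + z)` -/

theorem hasDerivAt_moebius {z : ℝ} (hz : 0 < z) :
    HasDerivAt (fun z : ℝ => 2 * z / (1 + z)) (2 / (1 + z) ^ 2) z := by
  have h := ((hasDerivAt_id z).const_mul 2).div ((hasDerivAt_id z).const_add 1)
    (show 1 + id z ≠ 0 by simp only [id]; positivity)
  refine h.congr_deriv ?_
  simp only [id]
  ring

theorem moebius_mem_Ioo {z : ℝ} (hz : z ∈ Set.Ioo (0 : ℝ) 1) :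
    2 * z / (1 + z) ∈ Set.Ioo (0 : ℝ) 1 := by
  have h0 := hz.1
  refine ⟨by positivity, ?_⟩
  rw [div_lt_one (by positivity)]
  linarith [hz.2]

theorem one_sub_moebius {z : ℝ} (hz : 0 < z) : 1 - 2 * z / (1 + z) = (1 - z) / (1 + z) := by
  field_simp
  ring

/-- The pullback of `A du / u + B du / (u - 1)` is
`A dz / z + B dz / (z - 1) - (A + B) dz / (z + 1)`. -/
theorem moebius_pullback (A B : NCSeries (Fin 2)) {z : ℝ} (hz : z ∈ Set.Ioo (0 : ℝ) 1) :
    ((2 / (1 + z) ^ 2 : ℝ) : ℂ) • ((((2 * z / (1 + z) : ℝ) : ℂ)⁻¹) • A +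
      ((((2 * z / (1 + z) : ℝ) : ℂ) - 1)⁻¹) • B) =
    ((z : ℂ)⁻¹) • A + (((z : ℂ) - 1)⁻¹) • B + (((z : ℂ) + 1)⁻¹) • (-A - B) := by
  have h0 : (z : ℂ) ≠ 0 := by exact_mod_cast hz.1.ne'
  have h1 : (z : ℂ) - 1 ≠ 0 := by rw [sub_ne_zero]; exact_mod_cast hz.2.ne
  have h2 : (1 : ℂ) + z ≠ 0 := by exact_mod_cast (by linarith [hz.1] : (0 : ℝ) < 1 + z).ne'
  have h2' : (z : ℂ) + 1 ≠ 0 := by rwa [add_comm]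
  have e : (2 * z / (1 + z) : ℂ) - 1 = (z - 1) / (1 + z) := by
    field_simp
    ring
  have eA : (2 / (1 + z) ^ 2 : ℂ) * (2 * z / (1 + z) : ℂ)⁻¹ = (z : ℂ)⁻¹ - ((z : ℂ) + 1)⁻¹ := by
    field_simp
    ring
  have eB : (2 / (1 + z) ^ 2 : ℂ) * ((z - 1) / (1 + z) : ℂ)⁻¹ =
      ((z : ℂ) - 1)⁻¹ - ((z : ℂ) + 1)⁻¹ := by
    field_simp
    ring
  push_cast
  rw [smul_add, smul_smul, smul_smul, e, eA, eB]
  module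

/-- The solution `G₀(u) 2 ^ (-A)` is asymptotic to `z ^ A` since `u / (2 z) → 1`, and the solution
`G₁(u) 2 ^ B` is asymptotic to `(1 - z) ^ B` since `2 (1 - u) / (1 - z) → 1`. -/
theorem IsKZAssociator.moebius {Φ : NCSeries (Fin 2)} (h : IsKZAssociator Φ) :
    IsRenormalizedHolonomy
      (fun z : ℝ => ((z : ℂ)⁻¹) • var (0 : Fin 2) + (((z : ℂ) - 1)⁻¹) • var (1 : Fin 2) +
        (((z : ℂ) + 1)⁻¹) • (-var 0 - var 1))
      (var 0) (var 1) (rpow 2 (-var 1) * Φ * rpow 2 (-var 0)) := by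
  obtain ⟨G₀, G₁, s₀, a₀, s₁, a₁, hP⟩ := h
  have hA := var_mem_degGE_one (0 : Fin 2)
  have hB := var_mem_degGE_one (1 : Fin 2)
  have hsol : ∀ G : ℝ → (NCSeries (Fin 2))ˣ, IsSolution (fun u : ℝ =>
      ((u : ℂ)⁻¹) • var (0 : Fin 2) + (((u : ℂ) - 1)⁻¹) • var (1 : Fin 2)) G →
      IsSolution (fun z : ℝ => ((z : ℂ)⁻¹) • var (0 : Fin 2) + (((z : ℂ) - 1)⁻¹) • var (1 : Fin 2) +
        (((z : ℂ) + 1)⁻¹) • (-var 0 - var 1)) (fun z => G (2 * z / (1 + z))) := by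
    intro G hG z hz w
    refine ((hG _ (moebius_mem_Ioo hz) w).scomp z (hasDerivAt_moebius hz.1)).congr_deriv ?_
    beta_reduce
    rw [← moebius_pullback _ _ hz, smul_mul_assoc, coeff_smul, Complex.real_smul]
  rw [isAsympZero_iff] at a₀
  rw [isAsympOne_iff] at a₁
  refine ⟨fun z => G₀ (2 * z / (1 + z)) * (rpowUnit hA 2)⁻¹,
    fun z => G₁ (2 * z / (1 + z)) * rpowUnit hB 2, (hsol _ s₀).mul_const _, ?_,
    (hsol _ s₁).mul_const _, ?_, fun z hz => ?_⟩
  · rw [isAsympZero_iff]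
    have ht : Filter.Tendsto (fun z : ℝ => 2 * z / (1 + z)) (nhdsWithin 0 (Set.Ioi 0))
        (nhdsWithin 0 (Set.Ioi 0)) := by
      refine tendsto_nhdsWithin_iff.2 ⟨?_, ?_⟩
      · have : ContinuousAt (fun z : ℝ => 2 * z / (1 + z)) 0 := by
          refine ContinuousAt.div (by fun_prop) (by fun_prop) (by norm_num)
        have h2 := this.tendsto
        rw [mul_zero, zero_div] at h2
        exact h2.mono_left nhdsWithin_le_nhds
      · filter_upwards [eventually_nhdsGT_zero] with z hz
        exact (moebius_mem_Ioo hz).1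
    have ht' : Filter.Tendsto (fun z : ℝ => 1 + z) (nhdsWithin 0 (Set.Ioi 0)) (nhds 1) := by
      have := (continuous_const_add (1 : ℝ)).tendsto 0
      rw [add_zero] at this
      exact this.mono_left nhdsWithin_le_nhds
    have h1 := (a₀.comp ht).mul (tendsto_rpow_one ht' (-var 0))
    rw [mul_one] at h1
    refine h1.congr' ?_
    filter_upwards [eventually_nhdsGT_zero] with z hz
    have h0 := hz.1
    have hl : Real.log (2 * z / (1 + z)) = Real.log 2 + Real.log z - Real.log (1 + z) := by
      rw [Real.log_div (by positivity) (by positivity), Real.log_mul (by positivity) h0.ne']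
    change (G₀ (2 * z / (1 + z)) : NCSeries (Fin 2)) * rpow (2 * z / (1 + z)) (-var 0) *
        rpow (1 + z) (-var 0) =
      (G₀ (2 * z / (1 + z)) : NCSeries (Fin 2)) * rpow 2 (-var 0) * rpow z (-var 0)
    simp only [mul_assoc, rpow_neg, exp_smul_mul_exp_smul hA, hl]
    congr 3
    push_cast
    ring
  · rw [isAsympOne_iff]
    have ht : Filter.Tendsto (fun z : ℝ => 2 * z / (1 + z)) (nhdsWithin 1 (Set.Iio 1))
        (nhdsWithin 1 (Set.Iio 1)) := by
      refine tendsto_nhdsWithin_iff.2 ⟨?_, ?_⟩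
      · have : ContinuousAt (fun z : ℝ => 2 * z / (1 + z)) 1 := by
          refine ContinuousAt.div (by fun_prop) (by fun_prop) (by norm_num)
        have h2 := this.tendsto
        rw [show (2 * 1 / (1 + 1) : ℝ) = 1 by norm_num] at h2
        exact h2.mono_left nhdsWithin_le_nhds
      · filter_upwards [eventually_nhdsLT_one] with z hz
        exact (moebius_mem_Ioo hz).2
    have ht' : Filter.Tendsto (fun z : ℝ => (1 + z) / 2) (nhdsWithin 1 (Set.Iio 1)) (nhds 1) := by
      have := ((continuous_const_add (1 : ℝ)).div_const 2).tendsto 1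
      rw [show ((1 + 1) / 2 : ℝ) = 1 by norm_num] at this
      exact this.mono_left nhdsWithin_le_nhds
    have h1 := (a₁.comp ht).mul (tendsto_rpow_one ht' (-var 1))
    rw [mul_one] at h1
    refine h1.congr' ?_
    filter_upwards [eventually_nhdsLT_one] with z hz
    have h0 := hz.1
    have h01 : 0 < 1 - z := by linarith [hz.2]
    have hl : Real.log (1 - 2 * z / (1 + z)) = Real.log (1 - z) - Real.log (1 + z) := by
      rw [one_sub_moebius h0, Real.log_div h01.ne' (by positivity)]
    have hl' : Real.log ((1 + z) / 2) = Real.log (1 + z) - Real.log 2 :=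
      Real.log_div (by positivity) (by positivity)
    change (G₁ (2 * z / (1 + z)) : NCSeries (Fin 2)) * rpow (1 - 2 * z / (1 + z)) (-var 1) *
        rpow ((1 + z) / 2) (-var 1) =
      (G₁ (2 * z / (1 + z)) : NCSeries (Fin 2)) * rpow 2 (var 1) * rpow (1 - z) (-var 1)
    simp only [mul_assoc, rpow_neg, hl, hl']
    rw [rpow, exp_smul_mul_exp_smul hB, exp_smul_mul_exp_smul hB]
    congr 3
    push_cast
    ring
  · rw [hP _ (moebius_mem_Ioo hz), mul_inv_rev, Units.val_mul, Units.val_mul]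
    simp only [mul_assoc]
    rfl

/-- The KZ associator `Φ(A, B)` and the generalized associator `Ψ₂(A | b₀, b₁)` exist and are
uniquely determined, and `Φ(A, B) = 2 ^ B * Ψ₂(A | B, -A - B) * 2 ^ A`. -/
theorem mainTheorem2 :
    (∃! Φ : NCSeries (Fin 2), IsKZAssociator Φ) ∧ (∃! Ψ : NCSeries (Fin 3), IsPsiTwo Ψ) ∧
    kzAssociator =
      NCSeries.rpow 2 (NCSeries.var 1) *
        NCSeries.subst
          (![NCSeries.var 0, NCSeries.var 1, -NCSeries.var 0 - NCSeries.var 1] :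
            Fin 3 → NCSeries (Fin 2)) psiTwo *
        NCSeries.rpow 2 (NCSeries.var 0) := by
  refine ⟨existsUnique_isKZAssociator, existsUnique_isPsiTwo, ?_⟩
  have hΦ : IsKZAssociator kzAssociator := Classical.epsilon_spec existsUnique_isKZAssociator.exists
  have hΨ : IsPsiTwo psiTwo := Classical.epsilon_spec existsUnique_isPsiTwo.exists
  have hA := var_mem_degGE_one (0 : Fin 2)
  have hB := var_mem_degGE_one (1 : Fin 2)
  set s : Fin 3 → NCSeries (Fin 2) := ![var 0, var 1, -var 0 - var 1] with hs_def
  have hs : ∀ x, s x ∈ degGE (Fin 2) 1 := by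
    intro x
    fin_cases x
    · exact hA
    · exact hB
    · exact sub_mem (neg_mem hA) hB
  have h1 := hΨ.subst (var_mem_degGE_one 0) (var_mem_degGE_one 1) hs
  have hω : (fun z : ℝ => subst s (((z : ℂ)⁻¹) • var (0 : Fin 3) +
      (((z : ℂ) - 1)⁻¹) • var (1 : Fin 3) + (((z : ℂ) + 1)⁻¹) • var (2 : Fin 3))) =
      fun z : ℝ => ((z : ℂ)⁻¹) • var (0 : Fin 2) + (((z : ℂ) - 1)⁻¹) • var (1 : Fin 2) +
        (((z : ℂ) + 1)⁻¹) • (-var 0 - var 1) := by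
    funext z
    rw [← substHom_apply hs, map_add, map_add, map_smul, map_smul, map_smul]
    simp only [substHom_apply, subst_var hs]
    rfl
  rw [hω, subst_var hs, subst_var hs] at h1
  have h2 : rpow 2 (-var 1) * kzAssociator * rpow 2 (-var 0) = subst s psiTwo :=
    h1.unique (fun u _ => add_mem (add_mem (Submodule.smul_mem _ _ hA) (Submodule.smul_mem _ _ hB))
      (Submodule.smul_mem _ _ (sub_mem (neg_mem hA) hB))) hΦ.moebius
  rw [← h2]
  simp only [mul_assoc, rpow_neg_mul_rpow hA, mul_one]
  rw [← mul_assoc, rpow_mul_rpow_neg hB, one_mul]
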